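/- **Theorem 3.5.** Let $\mathcal H_1,\mathcal H_2$ be complex separable Hilbert spaces and let $A:\operatorname{dom}(A)\subseteq\mathcal H_1\to\mathcal H_2$ be a densely defined, closed, linear operator with $\ker(A)=\{0\}$ and $\inf\sigma(A^*A)=0$. Let $\mathcal H_A$ be the completion of $\operatorname{dom}(A)$ with respect to the inner product $(f,g)_A=(Af,Ag)_{\mathcal H_2}$ (with norm $\|f\|_A=\|Af\|_{\mathcal H_2}$), let $\mathcal K_A=\overline{\operatorname{ran}(A)}\subseteq\mathcal H_2$, let $J_A:\mathcal H_1\supseteq\operatorname{dom}(A)\to\mathcal H_A$, $f\mapsto f$, and let $\widetilde A:\mathcal H_A\to\mathcal K_A$ be the unique unitary operator extending $\operatorname{dom}(A)\ni f\mapsto Af$. Define the unitary operator $$U_{\widetilde A}=\begin{pmatrix}0&I_{\mathcal H_1}\\-i\widetilde A&0\end{pmatrix}:\mathcal H_A\oplus\mathcal H_1\to\mathcal H_1\oplus\mathcal K_A,$$ the operator $$G_{A,0}=\begin{pmatrix}0&J_A\\-A^*\widetilde A&0\end{pmatrix},\qquad \operatorname{dom}(G_{A,0})=\operatorname{dom}(A^*\widetilde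 A)\oplus\operatorname{dom}(A)\subseteq\mathcal H_A\oplus\mathcal H_1,$$ where $\operatorname{dom}(A^*\widetilde A)=\{f\in\mathcal H_A\mid\widetilde Af\in\operatorname{dom}(A^*)\}$, and the operator $$Q_{A,0}=\begin{pmatrix}0&A^*\\A&0\end{pmatrix},\qquad \operatorname{dom}(Q_{A,0})=\operatorname{dom}(A)\oplus\operatorname{dom}(A^*)\subseteq\mathcal H_1\oplus\mathcal H_2,$$ and let $P_{\ker(Q_{A,0})}$ be the orthogonal projection of $\mathcal H_1\oplus\mathcal H_2$ onto $\ker(Q_{A,0})$. Then $$Q_{A,0}\big[I_{\mathcal H_1\oplus\mathcal H_2}-P_{\ker(Q_{A,0})}\big]=U_{\widetilde A}\,iG_{A,0}\,U_{\widetilde A}^{-1},$$ with equality of domains, in the following sense: the operator on the left maps the part of its domain lying in $\mathcal H_1\oplus\mathcal K_A$ into $\mathcal H_1\oplus\mathcal K_A$ and coincides there with the operator on the right; and on all of $\mathcal H_1\oplus\mathcal H_2=(\mathcal H_1\oplus\mathcal K_A)\oplus(\{0\}\oplus\mathcal K_A^{\perp})$ it is the orthogonal direct sum of the operator on the right and the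 zero operator. Moreover, $iG_{A,0}$ is self-adjoint in $\mathcal H_A\oplus\mathcal H_1$, $G_{A,0}$ generates a strongly continuous unitary group $e^{G_{A,0}t}$, $t\in\mathbb R$, in $\mathcal H_A\oplus\mathcal H_1$, and $G_{A,0}$ is unitarily equivalent to $-G_{A,0}$. -/

import Mathlib

noncomputable section

namespace AbstractWave

/-! ### Unbounded operators between complex inner product spaces -/

section Operators

variable {E F G : Type*}
  [NormedAddCommGroup E] [InnerProductSpace ℂ E]
  [NormedAddCommGroup F] [InnerProductSpace ℂ F]
  [NormedAddCommGroup G] [InnerProductSpace ℂ G]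

/-- The everywhere defined operator given by a linear map. -/
def everywhere (L : E →ₗ[ℂ] F) : E →ₗ.[ℂ] F := L.toPMap ⊤

/-- The product `S T` of two unbounded operators on its maximal domain
`{x ∈ dom T | T x ∈ dom S}`. -/
def opMul (S : F →ₗ.[ℂ] G) (T : E →ₗ.[ℂ] F) : E →ₗ.[ℂ] G where
  domain :=
    { carrier := {x | ∃ hx : x ∈ T.domain, T ⟨x, hx⟩ ∈ S.domain}
      zero_mem' := ⟨T.domain.zero_mem, by
        have h : T ⟨0, T.domain.zero_mem⟩ = 0 := T.map_zero
        rw [h]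
        exact S.domain.zero_mem⟩
      add_mem' := by
        rintro x y ⟨hx, hx'⟩ ⟨hy, hy'⟩
        refine ⟨T.domain.add_mem hx hy, ?_⟩
        have h : T ⟨x + y, T.domain.add_mem hx hy⟩ = T ⟨x, hx⟩ + T ⟨y, hy⟩ :=
          T.map_add ⟨x, hx⟩ ⟨y, hy⟩
        rw [h]
        exact S.domain.add_mem hx' hy'
      smul_mem' := by
        rintro c x ⟨hx, hx'⟩
        refine ⟨T.domain.smul_mem c hx, ?_⟩
        have h : T ⟨c • x, T.domain.smul_mem c hx⟩ = c • T ⟨x, hx⟩ := T.map_smul c ⟨x, hx⟩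
        rw [h]
        exact S.domain.smul_mem c hx' }
  toFun :=
    { toFun := fun x => S ⟨T ⟨x.1, x.2.fst⟩, x.2.snd⟩
      map_add' := by
        rintro ⟨x, hx, hx'⟩ ⟨y, hy, hy'⟩
        rw [← S.map_add]
        congr 1
        exact Subtype.ext (T.map_add ⟨x, hx⟩ ⟨y, hy⟩)
      map_smul' := by
        rintro c ⟨x, hx, hx'⟩
        rw [RingHom.id_apply, ← S.map_smul]
        congr 1
        exact Subtype.ext (T.map_smul c ⟨x, hx⟩) }

/-- The kernel `{x ∈ dom T | T x = 0}` of an unbounded operator, as a subspace of the whole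
space. -/
def opKer (T : E →ₗ.[ℂ] F) : Submodule ℂ E := (LinearMap.ker T.toFun).map T.domain.subtype

/-- The closure of the range of an unbounded operator. -/
def closedRange (T : E →ₗ.[ℂ] F) : Submodule ℂ F := (LinearMap.range T.toFun).topologicalClosure

instance (T : E →ₗ.[ℂ] F) [CompleteSpace F] : CompleteSpace (closedRange T) :=
  inferInstanceAs (CompleteSpace (LinearMap.range T.toFun).topologicalClosure)

theorem mem_closedRange (T : E →ₗ.[ℂ] F) (x : T.domain) : T x ∈ closedRange T :=
  Submodule.le_topologicalClosure _ ⟨x, rfl⟩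

/-- The resolvent set of an unbounded operator `T` in `E`: the `z` for which `T - z` has an
everywhere defined bounded two-sided inverse `R`. -/
def resolventSet (T : E →ₗ.[ℂ] E) : Set ℂ :=
  {z | ∃ R : E →L[ℂ] E,
    (∀ y : E, ∃ h : R y ∈ T.domain, T ⟨R y, h⟩ - z • R y = y) ∧
    ∀ x : T.domain, R (T x - z • (x : E)) = x}

/-- The spectrum of an unbounded operator. -/
def spectrumOf (T : E →ₗ.[ℂ] E) : Set ℂ := (resolventSet T)ᶜ

/-- The orthogonal projection onto the closure of a subspace `M` (so onto `M` itself if `M` is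
closed), as a bounded operator on the whole space. -/
def orthProj [CompleteSpace E] (M : Submodule ℂ E) : E →L[ℂ] E :=
  M.topologicalClosure.starProjection

/-- The off-diagonal block operator `(0 S; T 0)` in the Hilbert space direct sum `E ⊕ F`, with
domain `dom T ⊕ dom S`. -/
def offDiag (S : F →ₗ.[ℂ] E) (T : E →ₗ.[ℂ] F) :
    WithLp 2 (E × F) →ₗ.[ℂ] WithLp 2 (E × F) where
  domain :=
    { carrier := {x | x.fst ∈ T.domain ∧ x.snd ∈ S.domain}
      zero_mem' := ⟨T.domain.zero_mem, S.domain.zero_mem⟩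
      add_mem' := fun hx hy => ⟨T.domain.add_mem hx.1 hy.1, S.domain.add_mem hx.2 hy.2⟩
      smul_mem' := fun c _ hx => ⟨T.domain.smul_mem c hx.1, S.domain.smul_mem c hx.2⟩ }
  toFun :=
    { toFun := fun x => WithLp.toLp 2 (S ⟨x.1.snd, x.2.2⟩, T ⟨x.1.fst, x.2.1⟩)
      map_add' := by
        rintro ⟨x, hx⟩ ⟨y, hy⟩
        rw [← WithLp.toLp_add, Prod.mk_add_mk, ← S.map_add, ← T.map_add]
        rfl
      map_smul' := by
        rintro c ⟨x, hx⟩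
        rw [RingHom.id_apply, ← WithLp.toLp_smul, Prod.smul_mk, ← S.map_smul, ← T.map_smul]
        rfl }

/-- The operator `W T W⁻¹` for a unitary `W : E → F`, with domain `W (dom T)`. -/
def unitaryConj (W : E ≃ₗᵢ[ℂ] F) (T : E →ₗ.[ℂ] E) : F →ₗ.[ℂ] F where
  domain := T.domain.comap (W.symm.toLinearEquiv : F →ₗ[ℂ] E)
  toFun :=
    { toFun := fun y => W (T ⟨W.symm y.1, y.2⟩)
      map_add' := by
        rintro ⟨x, hx⟩ ⟨y, hy⟩
        rw [← W.map_add, ← T.map_add]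
        congr 2
        exact Subtype.ext (W.symm.map_add x y)
      map_smul' := by
        rintro c ⟨x, hx⟩
        rw [RingHom.id_apply, ← W.map_smul, ← T.map_smul]
        congr 2
        exact Subtype.ext (W.symm.map_smul c x) }

/-- Unitary equivalence of two unbounded operators in `E` and `F`. -/
def UnitarilyEquivalent (S : E →ₗ.[ℂ] E) (T : F →ₗ.[ℂ] F) : Prop :=
  ∃ W : E ≃ₗᵢ[ℂ] F, unitaryConj W S = T

/-- A strongly continuous one-parameter unitary group. -/
structure IsUnitaryGroup (V : ℝ → (E ≃ₗᵢ[ℂ] E)) : Prop where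
  map_zero : V 0 = LinearIsometryEquiv.refl ℂ E
  map_add : ∀ s t x, V (s + t) x = V s (V t x)
  continuous : ∀ x, Continuous fun t => V t x

/-- `T` is the generator of `V`: its domain is the set of `x` for which `t ↦ V t x` is
differentiable at `t = 0`, and then the derivative is `T x`. -/
def IsGeneratorOf (T : E →ₗ.[ℂ] E) (V : ℝ → (E ≃ₗᵢ[ℂ] E)) : Prop :=
  ∀ x y : E, (x, y) ∈ T.graph ↔ HasDerivAt (fun t : ℝ => V t x) y 0

/-- `T` generates a strongly continuous unitary group. -/
def GeneratesUnitaryGroup (T : E →ₗ.[ℂ] E) : Prop :=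
  ∃ V : ℝ → (E ≃ₗᵢ[ℂ] E), IsUnitaryGroup V ∧ IsGeneratorOf T V

end Operators

/-! ### The energy space and the operators attached to `A` -/

section Energy

variable {H₁ H₂ : Type*}
  [NormedAddCommGroup H₁] [InnerProductSpace ℂ H₁]
  [NormedAddCommGroup H₂] [InnerProductSpace ℂ H₂]

/-- The vector space `dom A`, to be equipped with `‖f‖_A = ‖A f‖`
(a norm as soon as `ker A = 0`) and `(f, g)_A = (A f, A g)`. -/
def EnergyDom (A : H₁ →ₗ.[ℂ] H₂) : Type _ := A.domain

instance (A : H₁ →ₗ.[ℂ] H₂) : AddCommGroup (EnergyDom A) :=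
  inferInstanceAs (AddCommGroup A.domain)

instance (A : H₁ →ₗ.[ℂ] H₂) : Module ℂ (EnergyDom A) :=
  inferInstanceAs (Module ℂ A.domain)

/-- `A` as a linear map on the vector space `dom A`. -/
def energyMap (A : H₁ →ₗ.[ℂ] H₂) : EnergyDom A →ₗ[ℂ] H₂ := A.toFun

instance (A : H₁ →ₗ.[ℂ] H₂) : SeminormedAddCommGroup (EnergyDom A) :=
  SeminormedAddCommGroup.induced (EnergyDom A) H₂ (energyMap A)

theorem energyDom_norm (A : H₁ →ₗ.[ℂ] H₂) (f : EnergyDom A) : ‖f‖ = ‖energyMap A f‖ := rfl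

instance (A : H₁ →ₗ.[ℂ] H₂) : InnerProductSpace ℂ (EnergyDom A) where
  norm_smul_le c f := by
    rw [energyDom_norm, energyDom_norm, map_smul, norm_smul]
  inner f g := inner ℂ (energyMap A f) (energyMap A g)
  norm_sq_eq_re_inner f := norm_sq_eq_re_inner (𝕜 := ℂ) (energyMap A f)
  conj_inner_symm f g := inner_conj_symm (𝕜 := ℂ) (energyMap A f) (energyMap A g)
  add_left f g h := by
    rw [map_add, inner_add_left]
  smul_left f g c := by
    rw [map_smul, inner_smul_left]

/-- The Hilbert space `H_A`: the completion of `dom A` under `‖f‖_A = ‖A f‖`. -/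
abbrev EnergySpace (A : H₁ →ₗ.[ℂ] H₂) : Type _ := UniformSpace.Completion (EnergyDom A)

/-- The canonical embedding of `dom A` into its completion `H_A`. -/
def toEnergySpace (A : H₁ →ₗ.[ℂ] H₂) : A.domain →ₗ[ℂ] EnergySpace A :=
  (UniformSpace.Completion.toComplₗᵢ (𝕜 := ℂ) (E := EnergyDom A)).toLinearMap

theorem norm_toEnergySpace (A : H₁ →ₗ.[ℂ] H₂) (f : A.domain) : ‖toEnergySpace A f‖ = ‖A f‖ :=
  UniformSpace.Completion.norm_coe (E := EnergyDom A) f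

theorem denseRange_toEnergySpace (A : H₁ →ₗ.[ℂ] H₂) : DenseRange (toEnergySpace A) :=
  UniformSpace.Completion.denseRange_coe (α := EnergyDom A)

/-- The operator `J_A` from `dom A ⊆ H₁` to `H_A`, `f ↦ f`. -/
def energyEmb (A : H₁ →ₗ.[ℂ] H₂) : H₁ →ₗ.[ℂ] EnergySpace A := ⟨A.domain, toEnergySpace A⟩

/-- `A` as a linear map from `dom A` to `K_A`, the closure of `ran A`. -/
def rangeMap (A : H₁ →ₗ.[ℂ] H₂) : A.domain →ₗ[ℂ] closedRange A :=
  A.toFun.codRestrict (closedRange A) (mem_closedRange A)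

theorem norm_rangeMap (A : H₁ →ₗ.[ℂ] H₂) (f : A.domain) :
    ‖rangeMap A f‖ = ‖toEnergySpace A f‖ :=
  (norm_toEnergySpace A f).symm

theorem denseRange_rangeMap (A : H₁ →ₗ.[ℂ] H₂) : DenseRange (rangeMap A) := by
  rintro ⟨y, hy⟩
  rw [closure_subtype]
  have hy' : y ∈ closure (LinearMap.range A.toFun : Set H₂) := hy
  refine closure_mono ?_ hy'
  rintro _ ⟨x, rfl⟩
  exact ⟨rangeMap A x, ⟨x, rfl⟩, rfl⟩

variable [CompleteSpace H₂]

/-- The continuous extension of `A : dom A → K_A` to `H_A`, as an isometry. -/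
def unitaryExtIsometry (A : H₁ →ₗ.[ℂ] H₂) : EnergySpace A →ₗᵢ[ℂ] closedRange A where
  toLinearMap := ((rangeMap A).extendOfNorm (toEnergySpace A)).toLinearMap
  norm_map' := by
    refine (denseRange_toEnergySpace A).induction ?_ (isClosed_eq (by
      simp only [ContinuousLinearMap.coe_coe]; fun_prop) continuous_norm)
    rintro _ ⟨f, rfl⟩
    simp only [ContinuousLinearMap.coe_coe]
    rw [LinearMap.extendOfNorm_eq (denseRange_toEnergySpace A)
      ⟨1, fun x => by rw [one_mul, norm_rangeMap]⟩, norm_rangeMap]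

theorem unitaryExtIsometry_apply (A : H₁ →ₗ.[ℂ] H₂) (f : A.domain) :
    unitaryExtIsometry A (toEnergySpace A f) = rangeMap A f :=
  LinearMap.extendOfNorm_eq (denseRange_toEnergySpace A)
    ⟨1, fun x => by rw [one_mul, norm_rangeMap]⟩ f

theorem unitaryExtIsometry_surjective (A : H₁ →ₗ.[ℂ] H₂) :
    Function.Surjective (unitaryExtIsometry A) := by
  have hc : IsClosed (Set.range (unitaryExtIsometry A)) :=
    (unitaryExtIsometry A).isometry.isClosedEmbedding.isClosed_range
  have hd : Dense (Set.range (unitaryExtIsometry A)) := by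
    refine Dense.mono ?_ (denseRange_rangeMap A)
    rintro _ ⟨x, rfl⟩
    exact ⟨toEnergySpace A x, unitaryExtIsometry_apply A x⟩
  rw [← Set.range_eq_univ, ← hc.closure_eq]
  exact hd.closure_eq

/-- The unitary extension `Ã : H_A → K_A` of `A`, where `K_A` is the closure of `ran A`. -/
def unitaryExt (A : H₁ →ₗ.[ℂ] H₂) : EnergySpace A ≃ₗᵢ[ℂ] closedRange A :=
  LinearIsometryEquiv.ofSurjective (unitaryExtIsometry A) (unitaryExtIsometry_surjective A)

/-- `Ã` extends `A`. -/
theorem unitaryExt_apply (A : H₁ →ₗ.[ℂ] H₂) (f : A.domain) :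
    (unitaryExt A (toEnergySpace A f) : H₂) = A f :=
  congrArg Subtype.val (unitaryExtIsometry_apply A f)

/-- The unitary block operator `U = (0 I; -i Ã 0) : H_A ⊕ H₁ → H₁ ⊕ K_A`, with inverse
`(0 i Ã⁻¹; I 0)`. -/
def blockUnitary (A : H₁ →ₗ.[ℂ] H₂) :
    WithLp 2 (EnergySpace A × H₁) ≃ₗᵢ[ℂ] WithLp 2 (H₁ × closedRange A) where
  toFun x := WithLp.toLp 2 (x.snd, -Complex.I • unitaryExt A x.fst)
  invFun y := WithLp.toLp 2 (Complex.I • (unitaryExt A).symm y.snd, y.fst)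
  map_add' x y := by
    rw [WithLp.add_fst, WithLp.add_snd, map_add, smul_add]
    rfl
  map_smul' c x := by
    rw [WithLp.smul_fst, WithLp.smul_snd, map_smul, smul_comm _ c]
    rfl
  left_inv x := by
    simp [smul_smul]
    rfl
  right_inv y := by
    simp [smul_smul]
    rfl
  norm_map' x := by
    simp [WithLp.prod_norm_eq_of_L2, norm_smul, add_comm]

/-- The inclusion of `H₁ ⊕ K_A` into `H₁ ⊕ H₂`. -/
def blockIncl (A : H₁ →ₗ.[ℂ] H₂) :
    WithLp 2 (H₁ × closedRange A) →ₗᵢ[ℂ] WithLp 2 (H₁ × H₂) where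
  toFun x := WithLp.toLp 2 (x.fst, (x.snd : H₂))
  map_add' _ _ := rfl
  map_smul' _ _ := rfl
  norm_map' x := by
    simp only [WithLp.prod_norm_eq_of_L2]
    rfl

variable [CompleteSpace H₁]

open scoped LinearPMap in
/-- The Dirac-type operator `Q = (0 A*; A 0)` in `H₁ ⊕ H₂`, with domain `dom A ⊕ dom A*`. -/
def diracOp (A : H₁ →ₗ.[ℂ] H₂) : WithLp 2 (H₁ × H₂) →ₗ.[ℂ] WithLp 2 (H₁ × H₂) :=
  offDiag A† A

open scoped LinearPMap in
/-- The operator `A* Ã` from `{f ∈ H_A | Ã f ∈ dom A*}` to `H₁`. -/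
def adjointExt (A : H₁ →ₗ.[ℂ] H₂) : EnergySpace A →ₗ.[ℂ] H₁ :=
  opMul A† (everywhere ((closedRange A).subtype ∘ₗ (unitaryExt A).toLinearEquiv.toLinearMap))

/-- The generator `G = (0 J_A; -A* Ã 0)` in `H_A ⊕ H₁`, with domain `dom (A* Ã) ⊕ dom A`. -/
def waveGen (A : H₁ →ₗ.[ℂ] H₂) :
    WithLp 2 (EnergySpace A × H₁) →ₗ.[ℂ] WithLp 2 (EnergySpace A × H₁) :=
  offDiag (energyEmb A) (-adjointExt A)

/-- The operator `Q (I - P)`, where `P` is the orthogonal projection onto `ker Q` (which is closed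
when `A` is closed and densely defined, because `Q` is then self-adjoint). -/
def reducedDirac (A : H₁ →ₗ.[ℂ] H₂) : WithLp 2 (H₁ × H₂) →ₗ.[ℂ] WithLp 2 (H₁ × H₂) :=
  opMul (diracOp A)
    (everywhere (ContinuousLinearMap.id ℂ _ - orthProj (opKer (diracOp A))).toLinearMap)

end Energy

end AbstractWave

end

/-! All operators are compared through their graphs, so equality of domains comes with equality of
values.

Since `A = Ã J_A`, conjugating `iG` by `U` turns it into `(0 A*; A 0)` restricted to `H₁ ⊕ K_A`
(`mem_graph_blockUnitary_conj`). On the other side, `ker A = 0` and `ker A* = (ran A)ᗮ` give `ker Q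
= 0 ⊕ K_Aᗮ`, so `I - P` is the identity on `H₁` plus the projection onto `K_A`
(`sub_orthProj_opKer_diracOp`). As `ran A ⊆ K_A`, the two descriptions agree.

The analytic statements rest on `G* = -G` (`isSkewAdjoint_waveGen`), which follows from unitarity of
`Ã` and `A** = A`. Then `iG` is self-adjoint, and the group comes from Stone's theorem, proved in
Hille–Yosida style. Skew-adjointness gives resolvents at all nonzero reals; these yield commuting
bounded skew-adjoint operators converging to `G` on its domain. Their exponentials are isometries
converging strongly, locally uniformly in time, and the limit is the group.

Finally, `(I 0; 0 -I)` anticommutes with any off-diagonal block operator and so conjugates `G` into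
`-G`. -/

noncomputable section

namespace AbstractWave

/-! ### Resolvents and bounded approximants of a skew-adjoint operator -/

section SkewAdjoint

variable {E : Type*} [NormedAddCommGroup E] [InnerProductSpace ℂ E]

/-- A skew-adjoint operator, `G* = -G`, in terms of its graph. -/
def IsSkewAdjoint (G : E →ₗ.[ℂ] E) : Prop :=
  ∀ x y : E, (x, y) ∈ G.graph ↔ ∀ z w : E, (z, w) ∈ G.graph → inner ℂ y z = -inner ℂ x w

namespace IsSkewAdjoint

variable {G : E →ₗ.[ℂ] E} (hG : IsSkewAdjoint G)
include hG

/-- Skew symmetry makes `⟪x, G x⟫` purely imaginary, so for real `r` the cross term vanishes. -/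
theorem norm_sub_sq {x y : E} (h : (x, y) ∈ G.graph) (r : ℝ) :
    ‖(r : ℂ) • x - y‖ ^ 2 = r ^ 2 * ‖x‖ ^ 2 + ‖y‖ ^ 2 := by
  have h1 : inner ℂ y x = -inner ℂ x y := (hG x y).1 h x y h
  have h2 : (inner ℂ x y : ℂ).re = 0 := by
    have h3 := congrArg Complex.re h1
    rw [← inner_conj_symm y x, Complex.conj_re, Complex.neg_re] at h3
    linarith
  rw [@_root_.norm_sub_sq ℂ, inner_smul_left, norm_smul]
  simp [h2, mul_pow]

theorem abs_mul_norm_le {x y : E} (h : (x, y) ∈ G.graph) (r : ℝ) :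
    |r| * ‖x‖ ≤ ‖(r : ℂ) • x - y‖ := by
  refine abs_le_of_sq_le_sq' ?_ (norm_nonneg _) |>.2
  rw [hG.norm_sub_sq h, mul_pow, sq_abs]
  nlinarith [sq_nonneg ‖y‖]

/-- Membership of `(x, r x - y)` in the graph encodes `(r - G) x = y`, here and in all resolvent
statements. Injectivity of `r - G` follows from its lower bound `|r|`. -/
theorem eq_of_mem_graph {r : ℝ} (hr : r ≠ 0) {x x' y : E} (h : (x, (r : ℂ) • x - y) ∈ G.graph)
    (h' : (x', (r : ℂ) • x' - y) ∈ G.graph) : x = x' := by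
  have h1 := G.graph.sub_mem h h'
  have h2 := hG.abs_mul_norm_le (x := x - x') h1 r
  have h3 : (r : ℂ) • (x - x') - ((r : ℂ) • x - y - ((r : ℂ) • x' - y)) = 0 := by
    rw [smul_sub]; abel
  rw [h3, norm_zero] at h2
  exact sub_eq_zero.1 (norm_le_zero_iff.1 (nonpos_of_mul_nonpos_right h2 (abs_pos.2 hr)))

theorem isClosed_graph : IsClosed (G.graph : Set (E × E)) := by
  have h : (G.graph : Set (E × E)) =
      ⋂ p ∈ G.graph, {q : E × E | inner ℂ q.2 p.1 = -inner ℂ q.1 p.2} := by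
    ext ⟨x, y⟩
    simp only [SetLike.mem_coe, Set.mem_iInter, Set.mem_ofPred_eq, Prod.forall]
    exact hG x y
  rw [h]
  exact isClosed_biInter fun p _ => isClosed_eq (by fun_prop) (by fun_prop)

variable [CompleteSpace E]

/-- If `y` is orthogonal to the domain, then `(0, y)` passes the test defining the graph, so `y = G
0 = 0`. -/
theorem dense_domain : Dense (G.domain : Set E) := by
  rw [Submodule.dense_iff_topologicalClosure_eq_top, Submodule.topologicalClosure_eq_top_iff,
    Submodule.eq_bot_iff]
  intro y hy
  refine LinearPMap.graph_fst_eq_zero_snd G (x := 0) ((hG 0 y).2 fun z w h => ?_) rfl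
  rw [inner_zero_left, neg_zero]
  exact (Submodule.mem_orthogonal' _ _).1 hy z (LinearPMap.mem_domain_of_mem_graph h)

theorem isSelfAdjoint_I_smul : IsSelfAdjoint (Complex.I • G) := by
  rw [LinearPMap.isSelfAdjoint_def]
  refine LinearPMap.eq_of_eq_graph ?_
  have hd : Dense ((Complex.I • G).domain : Set E) := hG.dense_domain
  have key : ∀ x y : E, (x, y) ∈ (Complex.I • G).graph ↔ (x, -Complex.I • y) ∈ G.graph := by
    intro x y
    simp only [LinearPMap.mem_graph_iff]
    refine exists_congr fun a => and_congr_right fun _ => ?_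
    change Complex.I • G a = y ↔ _
    constructor
    · rintro rfl
      simp [smul_smul]
    · intro h
      rw [h]
      simp [smul_smul]
  ext ⟨x, y⟩
  rw [LinearPMap.adjoint_graph_eq_graph_adjoint hd, Submodule.mem_adjoint_iff, key, hG]
  constructor
  · intro h z w hzw
    have h1 := h z (Complex.I • w) ((key _ _).2 (by simpa [smul_smul] using hzw))
    rw [sub_eq_zero] at h1
    have h2 := congrArg (starRingEnd ℂ) h1
    simp only [inner_conj_symm, inner_smul_right] at h2
    rw [inner_smul_left, ← h2, ← mul_assoc]
    simp
  · intro h a b hab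
    have h1 := h a _ ((key _ _).1 hab)
    rw [inner_smul_left, inner_smul_right] at h1
    have h2 : inner ℂ y a = inner ℂ x b := by
      have := congrArg (fun c => -Complex.I * c) h1
      simpa [← mul_assoc] using this
    rw [sub_eq_zero, ← inner_conj_symm b, ← inner_conj_symm a, h2]

/-- On the complete space `G.graph`, the map `r - G` is bounded and bounded below, hence has closed
range; the range is also dense, because a vector orthogonal to it is an eigenvector of `G` for `-r`.
-/
theorem exists_resolvent {r : ℝ} (hr : r ≠ 0) (y : E) :
    ∃ x, (x, (r : ℂ) • x - y) ∈ G.graph := by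
  let L : G.graph →L[ℂ] E :=
    ((r : ℂ) • ContinuousLinearMap.fst ℂ E E - ContinuousLinearMap.snd ℂ E E) ∘L G.graph.subtypeL
  have hL : ∀ p : G.graph, L p = (r : ℂ) • p.1.1 - p.1.2 := fun p => rfl
  have : CompleteSpace G.graph := hG.isClosed_graph.completeSpace_coe
  obtain ⟨c, hc⟩ : ∃ c : NNReal, AntilipschitzWith c L := by
    -- The graph carries the sup norm: the first coordinate is at most `|r|⁻¹ ‖L p‖`, the second at
    -- most `‖L p‖`, and the sum of the constants dominates both.
    refine ⟨⟨|r|⁻¹ + 1, by positivity⟩, ContinuousLinearMap.antilipschitz_of_bound _ fun p => ?_⟩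
    have h1 := hG.abs_mul_norm_le p.2 r
    have h2 := hG.norm_sub_sq p.2 r
    rw [← hL] at h1 h2
    have h3 : ‖p.1.2‖ ≤ ‖L p‖ := by
      refine abs_le_of_sq_le_sq' ?_ (norm_nonneg _) |>.2
      rw [h2]
      nlinarith [mul_nonneg (sq_nonneg r) (sq_nonneg ‖p.1.1‖)]
    have h4 : ‖p.1.1‖ ≤ |r|⁻¹ * ‖L p‖ := by
      rw [inv_mul_eq_div, le_div_iff₀ (abs_pos.2 hr)]
      linarith
    change max ‖p.1.1‖ ‖p.1.2‖ ≤ (|r|⁻¹ + 1) * ‖L p‖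
    have h5 : 0 ≤ |r|⁻¹ * ‖L p‖ := by positivity
    refine max_le ?_ ?_ <;> nlinarith [norm_nonneg (L p)]
  have hcl : IsClosed (L.range : Set E) := hc.isClosed_range L.uniformContinuous
  have htop : L.range = ⊤ := by
    rw [← hcl.submodule_topologicalClosure_eq, Submodule.topologicalClosure_eq_top_iff,
      Submodule.eq_bot_iff]
    intro u hu
    have h1 : (u, -((r : ℂ) • u)) ∈ G.graph := by
      refine (hG _ _).2 fun z w hzw => ?_
      have h2 := (Submodule.mem_orthogonal' _ _).1 hu _ ⟨⟨(z, w), hzw⟩, rfl⟩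
      change inner ℂ u ((r : ℂ) • z - w) = 0 at h2
      rw [inner_sub_right, inner_smul_right, sub_eq_zero] at h2
      rw [inner_neg_left, inner_smul_left, Complex.conj_ofReal, h2]
    have h2 := hG.abs_mul_norm_le h1 (-r)
    have h3 : ((-r : ℝ) : ℂ) • u - -((r : ℂ) • u) = 0 := by simp
    rw [h3, norm_zero, abs_neg] at h2
    have := abs_pos.2 hr
    exact norm_le_zero_iff.1 (nonpos_of_mul_nonpos_right h2 this)
  obtain ⟨p, hp⟩ : y ∈ L.range := htop ▸ Submodule.mem_top
  refine ⟨p.1.1, ?_⟩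
  have h : (r : ℂ) • p.1.1 - y = p.1.2 := by
    rw [← hp]
    change _ - ((r : ℂ) • p.1.1 - p.1.2) = _
    abel
  rw [h]
  exact p.2

/-- The resolvent of a skew-adjoint operator at a nonzero real number. -/
theorem exists_resolventCLM {r : ℝ} (hr : r ≠ 0) :
    ∃ R : E →L[ℂ] E, (∀ y, (R y, (r : ℂ) • R y - y) ∈ G.graph) ∧ ∀ y, ‖R y‖ ≤ |r|⁻¹ * ‖y‖ := by
  choose f hf using hG.exists_resolvent hr
  let R : E →ₗ[ℂ] E :=
    { toFun := f
      map_add' := fun x y => hG.eq_of_mem_graph hr (hf _) (by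
        have := G.graph.add_mem (hf x) (hf y)
        rw [Prod.mk_add_mk] at this
        convert! this using 2
        rw [smul_add]; abel)
      map_smul' := fun c x => hG.eq_of_mem_graph hr (hf _) (by
        have := G.graph.smul_mem c (hf x)
        rw [Prod.smul_mk] at this
        convert! this using 2
        rw [smul_sub, RingHom.id_apply, smul_comm]) }
  have hb : ∀ y, ‖R y‖ ≤ |r|⁻¹ * ‖y‖ := fun y => by
    have := hG.abs_mul_norm_le (hf y) r
    rw [sub_sub_cancel] at this
    rw [inv_mul_eq_div, le_div_iff₀ (abs_pos.2 hr), mul_comm]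
    exact this
  exact ⟨R.mkContinuous _ hb, hf, hb⟩

/-- Resolvents at nonzero real numbers, chosen all at once. -/
def res (r : ℝ) : E →L[ℂ] E :=
  if hr : r ≠ 0 then (hG.exists_resolventCLM hr).choose else 0

variable {r s : ℝ}

theorem res_mem (hr : r ≠ 0) (y : E) : (hG.res r y, (r : ℂ) • hG.res r y - y) ∈ G.graph := by
  rw [res, dif_pos hr]
  exact (hG.exists_resolventCLM hr).choose_spec.1 y

theorem norm_res_le (hr : r ≠ 0) (y : E) : ‖hG.res r y‖ ≤ |r|⁻¹ * ‖y‖ := by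
  rw [res, dif_pos hr]
  exact (hG.exists_resolventCLM hr).choose_spec.2 y

theorem res_apply_of_mem (hr : r ≠ 0) {x y : E} (h : (x, y) ∈ G.graph) :
    (r : ℂ) • hG.res r x = x + hG.res r y := by
  have h1 := hG.eq_of_mem_graph hr (hG.res_mem hr ((r : ℂ) • x - y)) (x' := x)
    (by rwa [sub_sub_cancel])
  rw [map_sub, map_smul] at h1
  exact sub_eq_iff_eq_add.1 h1

theorem res_mem_of_mem (hr : r ≠ 0) {x y : E} (h : (x, y) ∈ G.graph) :
    (hG.res r x, hG.res r y) ∈ G.graph := by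
  have h1 := hG.res_mem hr x
  rwa [hG.res_apply_of_mem hr h, add_sub_cancel_left] at h1

/-- The resolvent at `r` commutes with `G`, so both products solve the same equation for `s - G`,
whose solution is unique. -/
theorem res_commute (hr : r ≠ 0) (hs : s ≠ 0) : Commute (hG.res r) (hG.res s) := by
  ext y
  refine hG.eq_of_mem_graph hs ?_ (hG.res_mem hs (hG.res r y))
  have h := hG.res_mem_of_mem hr (hG.res_mem hs y)
  rwa [map_sub, map_smul] at h

/-- Formally `(r - G)* = r + G = -(-r - G)`. -/
theorem star_res (hr : r ≠ 0) : star (hG.res r) = -hG.res (-r) := by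
  rw [ContinuousLinearMap.star_eq_adjoint, eq_comm, ContinuousLinearMap.eq_adjoint_iff]
  intro x y
  have h1 := hG.res_mem (neg_ne_zero.2 hr) x
  have h2 := hG.res_mem hr y
  have h3 := (hG _ _).1 h1 _ _ h2
  rw [inner_sub_left, inner_sub_right, inner_smul_left, inner_smul_right, Complex.conj_ofReal,
    Complex.ofReal_neg] at h3
  rw [neg_apply, inner_neg_left]
  linear_combination h3

/-- On the domain, `r R x - x = R (G x)` has norm at most `|r|⁻¹ ‖G x‖`; since `r R` is a
contraction, density extends the limit to every vector. Signs are left free so that both `n + 1` and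
`-(n + 1)` are covered. -/
theorem tendsto_smul_res {l : ℕ → ℝ} (hl0 : ∀ n, l n ≠ 0)
    (hl : Filter.Tendsto (fun n => |l n|⁻¹) Filter.atTop (nhds 0)) (y : E) :
    Filter.Tendsto (fun n => ((l n : ℝ) : ℂ) • hG.res (l n) y) Filter.atTop (nhds y) := by
  have hb : ∀ n z, ‖((l n : ℝ) : ℂ) • hG.res (l n) z‖ ≤ ‖z‖ := fun n z => by
    rw [norm_smul, Complex.norm_real, Real.norm_eq_abs]
    have := mul_le_mul_of_nonneg_left (hG.norm_res_le (hl0 n) z) (abs_nonneg (l n))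
    rwa [← mul_assoc, mul_inv_cancel₀ (abs_ne_zero.2 (hl0 n)), one_mul] at this
  rw [Metric.tendsto_atTop]
  intro ε hε
  obtain ⟨x, hx, hxy⟩ := Metric.mem_closure_iff.1 (hG.dense_domain y) (ε / 3) (by positivity)
  obtain ⟨w, hw⟩ := LinearPMap.mem_domain_iff.1 hx
  have h0 : Filter.Tendsto (fun n => |l n|⁻¹ * ‖w‖) Filter.atTop (nhds 0) := by
    simpa using hl.mul_const ‖w‖
  obtain ⟨N, hN⟩ := (h0.eventually_lt_const (show (0 : ℝ) < ε / 3 by positivity)).exists_forall_of_atTop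
  refine ⟨N, fun n hn => ?_⟩
  rw [dist_eq_norm] at hxy ⊢
  have h1 : ((l n : ℝ) : ℂ) • hG.res (l n) y - y =
      ((l n : ℝ) : ℂ) • hG.res (l n) (y - x) + hG.res (l n) w - (y - x) := by
    rw [map_sub, smul_sub, hG.res_apply_of_mem (hl0 n) hw]; abel
  rw [h1]
  calc _ ≤ ‖((l n : ℝ) : ℂ) • hG.res (l n) (y - x)‖ + ‖hG.res (l n) w‖ + ‖y - x‖ :=
        (norm_sub_le _ _).trans (by gcongr; exact norm_add_le _ _)
    _ ≤ ‖y - x‖ + |l n|⁻¹ * ‖w‖ + ‖y - x‖ := by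
        gcongr
        · exact hb _ _
        · exact hG.norm_res_le (hl0 n) w
    _ < ε := by linarith [hN n hn]

/-- Bounded skew-adjoint approximants of a skew-adjoint operator. -/
def yosida (n : ℕ) : E →L[ℂ] E :=
  -- With `r = n + 1`, this is the average of the Yosida approximants `r² R_r - r` and `r² R_{-r} +
  -- r`, formally `r² G (r² - G²)⁻¹`. Averaging over both signs makes it skew-adjoint, and the shift
  -- by one avoids `r = 0`.
  (((n + 1 : ℝ) ^ 2 / 2 : ℝ) : ℂ) • (hG.res (n + 1) + hG.res (-(n + 1)))

omit hG in
theorem natCast_add_one_real_ne_zero (n : ℕ) : (n + 1 : ℝ) ≠ 0 := Nat.cast_add_one_ne_zero n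

theorem star_yosida (n : ℕ) : star (hG.yosida n) = -hG.yosida n := by
  have h := natCast_add_one_real_ne_zero n
  rw [yosida, star_smul, star_add, hG.star_res h, hG.star_res (neg_ne_zero.2 h), neg_neg,
    ← smul_neg, Complex.star_def, Complex.conj_ofReal]
  congr 1
  abel

theorem yosida_commute (m n : ℕ) : Commute (hG.yosida m) (hG.yosida n) := by
  have hm := natCast_add_one_real_ne_zero m
  have hn := natCast_add_one_real_ne_zero n
  refine Commute.smul_left (Commute.smul_right ?_ _) _
  exact ((hG.res_commute hm hn).add_right (hG.res_commute hm (neg_ne_zero.2 hn))).add_left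
    ((hG.res_commute (neg_ne_zero.2 hm) hn).add_right
      (hG.res_commute (neg_ne_zero.2 hm) (neg_ne_zero.2 hn)))

/-- On the domain the approximant applied to `x` is the mean of `r R_r y` and `(-r) R_{-r} y`, each
of which tends to `y = G x`. -/
theorem tendsto_yosida {x y : E} (h : (x, y) ∈ G.graph) :
    Filter.Tendsto (fun n => hG.yosida n x) Filter.atTop (nhds y) := by
  have h0 : Filter.Tendsto (fun n : ℕ => |(n + 1 : ℝ)|⁻¹) Filter.atTop (nhds 0) := by
    refine (tendsto_one_div_add_atTop_nhds_zero_nat (𝕜 := ℝ)).congr fun n => ?_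
    rw [abs_of_pos (by positivity), one_div]
  have h1 := hG.tendsto_smul_res natCast_add_one_real_ne_zero h0 y
  have h2 := hG.tendsto_smul_res (fun n => neg_ne_zero.2 (natCast_add_one_real_ne_zero n))
    (by simpa only [abs_neg] using h0) y
  have h3 := (h1.add h2).const_smul (1 / 2 : ℂ)
  have h4 : (1 / 2 : ℂ) • (y + y) = y := by
    rw [← two_smul ℂ, smul_smul]; norm_num
  rw [h4] at h3
  refine h3.congr fun n => ?_
  have hn := natCast_add_one_real_ne_zero n
  have e1 := hG.res_apply_of_mem hn h
  have e2 := hG.res_apply_of_mem (neg_ne_zero.2 hn) h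
  simp only [yosida, smul_apply, add_apply]
  rw [← sub_eq_iff_eq_add'] at e1 e2
  rw [← e1, ← e2]
  push_cast
  module

end IsSkewAdjoint

end SkewAdjoint
end AbstractWave
namespace AbstractWave

/-! ### Exponentials of bounded skew-adjoint operators -/

section Exponential

open NormedSpace Filter Topology

variable {E : Type*} [NormedAddCommGroup E] [InnerProductSpace ℂ E] [CompleteSpace E]
  {D D' : E →L[ℂ] E}

theorem star_real_smul (hD : star D = -D) (t : ℝ) : star (t • D) = -(t • D) := by
  rw [star_smul, hD, smul_neg, star_trivial]

theorem norm_exp_smul_apply (hD : star D = -D) (t : ℝ) (x : E) : ‖exp (t • D) x‖ = ‖x‖ := by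
  let _ : NormedAlgebra ℚ (E →L[ℂ] E) := NormedAlgebra.restrictScalars ℚ ℂ _
  have h : exp (t • D) ∈ unitary (E →L[ℂ] E) :=
    exp_mem_unitary_of_mem_skewAdjoint (skewAdjoint.mem_iff.2 (star_real_smul hD t))
  exact (Unitary.linearIsometryEquiv ⟨_, h⟩).norm_map x

theorem hasDerivAt_exp_smul_apply (D : E →L[ℂ] E) (t : ℝ) (x : E) :
    HasDerivAt (fun t : ℝ => exp (t • D) x) (exp (t • D) (D x)) t := by
  have h := hasDerivAt_exp_smul_const (𝕂 := ℝ) D t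
  exact ((ContinuousLinearMap.apply ℂ E x).restrictScalars ℝ).hasFDerivAt.comp_hasDerivAt t h

theorem norm_exp_smul_apply_sub_le (hD : star D = -D) (t : ℝ) (x : E) :
    ‖exp (t • D) x - x‖ ≤ |t| * ‖D x‖ := by
  have h := Convex.norm_image_sub_le_of_norm_hasDerivWithin_le (C := ‖D x‖) (x := 0) (y := t)
    (fun s _ => (hasDerivAt_exp_smul_apply D s x).hasDerivWithinAt)
    (fun s _ => (norm_exp_smul_apply hD s (D x)).le) convex_univ trivial trivial
  simpa [mul_comm] using h

/-- Commutation factors `exp (tD)` as `exp (tD') exp (t(D - D'))`; the first factor is an isometry,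
and `D - D'` is again skew-adjoint, so the mean value bound applies to it. -/
theorem norm_exp_smul_apply_sub_exp_smul_apply_le (hD : star D = -D) (hD' : star D' = -D')
    (hc : Commute D D') (t : ℝ) (x : E) :
    ‖exp (t • D) x - exp (t • D') x‖ ≤ |t| * ‖D x - D' x‖ := by
  let _ : NormedAlgebra ℚ (E →L[ℂ] E) := NormedAlgebra.restrictScalars ℚ ℂ _
  have h1 : exp (t • D) = exp (t • D') * exp (t • (D - D')) := by
    rw [← exp_add_of_commute]
    · congr 1
      module
    · exact ((hc.symm.sub_right (Commute.refl D')).smul_right t).smul_left t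
  rw [h1, mul_apply_eq_comp, ← map_sub, norm_exp_smul_apply hD']
  refine norm_exp_smul_apply_sub_le ?_ t x
  rw [star_sub, hD, hD']
  abel

theorem exp_add_smul_apply (D : E →L[ℂ] E) (s t : ℝ) (x : E) :
    exp ((s + t) • D) x = exp (s • D) (exp (t • D) x) := by
  let _ : NormedAlgebra ℚ (E →L[ℂ] E) := NormedAlgebra.restrictScalars ℚ ℂ _
  rw [add_smul, exp_add_of_commute, mul_apply_eq_comp]
  exact ((Commute.refl D).smul_right t).smul_left s

end Exponential

/-! ### Stone's theorem by passage to the limit -/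

namespace IsSkewAdjoint

open NormedSpace Filter Topology

variable {E : Type*} [NormedAddCommGroup E] [InnerProductSpace ℂ E] [CompleteSpace E]
  {G : E →ₗ.[ℂ] E} (hG : IsSkewAdjoint G)
include hG

/-- For `x` in the domain, the exponentials differ by at most `|t|` times the difference of the
approximants at `x`, which is Cauchy. A general `y` is within `ε / 3` of such an `x`, an error that
the isometries preserve. -/
theorem uniformCauchySeqOn_exp (r : ℝ) (y : E) :
    UniformCauchySeqOn (fun (n : ℕ) (t : ℝ) => exp (t • hG.yosida n) y) atTop
      (Metric.ball 0 r) := by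
  rcases le_or_gt r 0 with hr | hr
  · rw [Metric.ball_eq_empty.2 hr]
    exact fun u _ => Eventually.of_forall fun _ _ h => h.elim
  rw [Metric.uniformCauchySeqOn_iff]
  intro ε hε
  obtain ⟨x, hx, hxy⟩ := Metric.mem_closure_iff.1 (hG.dense_domain y) (ε / 3) (by positivity)
  obtain ⟨w, hw⟩ := LinearPMap.mem_domain_iff.1 hx
  obtain ⟨N, hN⟩ := Metric.cauchySeq_iff.1 (hG.tendsto_yosida hw).cauchySeq (ε / 3 / r)
    (by positivity)
  refine ⟨N, fun m hm n hn t ht => ?_⟩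
  rw [dist_eq_norm] at hxy ⊢
  have h1 : exp (t • hG.yosida m) y - exp (t • hG.yosida n) y =
      exp (t • hG.yosida m) (y - x) + (exp (t • hG.yosida m) x - exp (t • hG.yosida n) x)
        - exp (t • hG.yosida n) (y - x) := by
    rw [map_sub, map_sub]; abel
  have h2 := norm_exp_smul_apply_sub_exp_smul_apply_le (hG.star_yosida m) (hG.star_yosida n)
    (hG.yosida_commute m n) t x
  have h3 : |t| * ‖hG.yosida m x - hG.yosida n x‖ ≤ r * (ε / 3 / r) := by
    have h4 := hN m hm n hn
    rw [dist_eq_norm] at h4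
    rw [mem_ball_zero_iff, Real.norm_eq_abs] at ht
    gcongr
  rw [mul_div_cancel₀ _ hr.ne'] at h3
  rw [h1]
  calc _ ≤ ‖exp (t • hG.yosida m) (y - x)‖
          + ‖exp (t • hG.yosida m) x - exp (t • hG.yosida n) x‖
          + ‖exp (t • hG.yosida n) (y - x)‖ :=
        (norm_sub_le _ _).trans (by gcongr; exact norm_add_le _ _)
    _ < ε := by
        rw [norm_exp_smul_apply (hG.star_yosida m), norm_exp_smul_apply (hG.star_yosida n)]
        linarith

theorem exists_tendsto_exp (t : ℝ) (y : E) :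
    ∃ z, Tendsto (fun n => exp (t • hG.yosida n) y) atTop (𝓝 z) :=
  cauchySeq_tendsto_of_complete
    ((hG.uniformCauchySeqOn_exp (|t| + 1) y).cauchySeq (x := t) (by simp))

/-- The limit of the exponentials of the bounded approximants. -/
def expLim (t : ℝ) (y : E) : E := (hG.exists_tendsto_exp t y).choose

theorem tendsto_expLim (t : ℝ) (y : E) :
    Tendsto (fun n => exp (t • hG.yosida n) y) atTop (𝓝 (hG.expLim t y)) :=
  (hG.exists_tendsto_exp t y).choose_spec

theorem norm_expLim (t : ℝ) (y : E) : ‖hG.expLim t y‖ = ‖y‖ :=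
  tendsto_nhds_unique (hG.tendsto_expLim t y).norm
    (tendsto_const_nhds.congr fun n => (norm_exp_smul_apply (hG.star_yosida n) t y).symm)

theorem expLim_zero (y : E) : hG.expLim 0 y = y :=
  tendsto_nhds_unique (hG.tendsto_expLim 0 y) (tendsto_const_nhds.congr fun _ => by simp)

/-- Isometries do not amplify the error `u n - y`, so a moving argument is allowed. This is what
carries the group law to the limit. -/
theorem tendsto_exp_of_tendsto {t : ℝ} {u : ℕ → E} {y : E} (hu : Tendsto u atTop (𝓝 y)) :
    Tendsto (fun n => exp (t • hG.yosida n) (u n)) atTop (𝓝 (hG.expLim t y)) := by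
  have h1 : Tendsto (fun n => exp (t • hG.yosida n) (u n - y)) atTop (𝓝 0) := by
    rw [tendsto_zero_iff_norm_tendsto_zero]
    refine (tendsto_iff_norm_sub_tendsto_zero.1 hu).congr fun n => ?_
    rw [norm_exp_smul_apply (hG.star_yosida n)]
  have h2 := h1.add (hG.tendsto_expLim t y)
  rw [zero_add] at h2
  refine h2.congr fun n => ?_
  rw [map_sub, sub_add_cancel]

theorem expLim_add (s t : ℝ) (y : E) : hG.expLim (s + t) y = hG.expLim s (hG.expLim t y) :=
  tendsto_nhds_unique (hG.tendsto_expLim (s + t) y)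
    ((hG.tendsto_exp_of_tendsto (hG.tendsto_expLim t y)).congr fun _ =>
      (exp_add_smul_apply _ s t y).symm)

/-- The unitary group generated by a skew-adjoint operator. -/
def unitaryGroup (t : ℝ) : E ≃ₗᵢ[ℂ] E where
  toFun := hG.expLim t
  invFun := hG.expLim (-t)
  map_add' x y := tendsto_nhds_unique (hG.tendsto_expLim t (x + y))
    (((hG.tendsto_expLim t x).add (hG.tendsto_expLim t y)).congr fun _ => (map_add _ x y).symm)
  map_smul' c x := tendsto_nhds_unique (hG.tendsto_expLim t (c • x))
    (((hG.tendsto_expLim t x).const_smul c).congr fun _ => (map_smul _ c x).symm)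
  left_inv x := by rw [← hG.expLim_add, neg_add_cancel, hG.expLim_zero]
  right_inv x := by rw [← hG.expLim_add, add_neg_cancel, hG.expLim_zero]
  norm_map' := hG.norm_expLim t

theorem tendstoUniformlyOn_exp (r : ℝ) (y : E) :
    TendstoUniformlyOn (fun (n : ℕ) (t : ℝ) => exp (t • hG.yosida n) y)
      (fun t => hG.expLim t y) atTop (Metric.ball 0 r) :=
  (hG.uniformCauchySeqOn_exp r y).tendstoUniformlyOn_of_tendsto
    fun t _ => hG.tendsto_expLim t y

theorem continuous_expLim (y : E) : Continuous fun t => hG.expLim t y := by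
  refine continuous_iff_continuousAt.2 fun t => ?_
  refine ((hG.tendstoUniformlyOn_exp (|t| + 1) y).continuousOn (Frequently.of_forall fun n =>
    Continuous.continuousOn <| continuous_iff_continuousAt.2 fun s =>
      (hasDerivAt_exp_smul_apply _ s y).continuousAt)).continuousAt
    (Metric.isOpen_ball.mem_nhds (by simp))

/-- The derivatives `exp (t Dₙ) (Dₙ x)` converge to the limit group applied to `y = G x`, uniformly
for `|t| < 1`, so limit and derivative may be exchanged. -/
theorem hasDerivAt_expLim {x y : E} (h : (x, y) ∈ G.graph) :
    HasDerivAt (fun t : ℝ => hG.expLim t x) y 0 := by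
  have hu : TendstoUniformlyOn (fun (n : ℕ) (t : ℝ) => exp (t • hG.yosida n) (hG.yosida n x))
      (fun t => hG.expLim t y) atTop (Metric.ball 0 1) := by
    rw [Metric.tendstoUniformlyOn_iff]
    intro ε hε
    filter_upwards [Metric.tendstoUniformlyOn_iff.1 (hG.tendstoUniformlyOn_exp 1 y) (ε / 2)
      (by positivity), Metric.tendsto_nhds.1 (hG.tendsto_yosida h) (ε / 2) (by positivity)]
      with n h1 h2 t ht
    calc _ ≤ dist (hG.expLim t y) (exp (t • hG.yosida n) y)
          + dist (exp (t • hG.yosida n) y) (exp (t • hG.yosida n) (hG.yosida n x)) :=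
          dist_triangle _ _ _
      _ < ε := by
          have h3 := h1 t ht
          rw [dist_eq_norm (exp (t • hG.yosida n) y), ← map_sub,
            norm_exp_smul_apply (hG.star_yosida n), ← dist_eq_norm, dist_comm y]
          linarith
  have := hasDerivAt_of_tendstoUniformlyOn Metric.isOpen_ball hu
    (Eventually.of_forall fun n t _ => hasDerivAt_exp_smul_apply (hG.yosida n) t x)
    (fun t _ => hG.tendsto_expLim t x) (Metric.mem_ball_self one_pos)
  rwa [hG.expLim_zero] at this

/-- **Stone's theorem**: a skew-adjoint operator generates a strongly continuous unitary group. -/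
theorem generatesUnitaryGroup : GeneratesUnitaryGroup G := by
  refine ⟨hG.unitaryGroup, ⟨?_, hG.expLim_add, hG.continuous_expLim⟩,
    fun x y => ⟨hG.hasDerivAt_expLim, fun h => (hG x y).2 fun z w hzw => ?_⟩⟩
  · ext x
    exact hG.expLim_zero x
  -- The generator has no larger domain than `G`: differentiating `⟪V t x, z⟫ = ⟪x, V (-t) z⟫` at
  -- `0`, for `z` in the domain of `G`, gives exactly the test that places `(x, y)` in the graph.
  · have h1 : HasDerivAt (fun t : ℝ => hG.expLim (-t) z) (-w) 0 := by
      simpa [Function.comp_def] using HasDerivAt.scomp_of_eq (0 : ℝ) (hG.hasDerivAt_expLim hzw)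
        (hasDerivAt_neg (0 : ℝ)) (by simp)
    have h2 := h.inner ℂ (hasDerivAt_const (0 : ℝ) z)
    have h3 := (hasDerivAt_const (0 : ℝ) x).inner ℂ h1
    have h4 : (fun t : ℝ => inner ℂ (hG.unitaryGroup t x) z) =
        fun t : ℝ => inner ℂ x (hG.expLim (-t) z) := by
      ext t
      rw [← (hG.unitaryGroup t).inner_map_map x]
      congr 1
      exact ((hG.unitaryGroup t).apply_symm_apply z).symm
    rw [h4] at h2
    have h5 := h2.unique h3
    simpa using h5

end IsSkewAdjoint
end AbstractWave
namespace AbstractWave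

open scoped LinearPMap

/-! ### Graph calculus for unbounded operators -/

section Graphs

variable {E F G : Type*}
  [NormedAddCommGroup E] [InnerProductSpace ℂ E]
  [NormedAddCommGroup F] [InnerProductSpace ℂ F]
  [NormedAddCommGroup G] [InnerProductSpace ℂ G]

theorem mem_graph_iff_exists {T : E →ₗ.[ℂ] F} {x : E} {y : F} :
    (x, y) ∈ T.graph ↔ ∃ h : x ∈ T.domain, T ⟨x, h⟩ = y := by
  rw [LinearPMap.mem_graph_iff]
  exact ⟨fun ⟨⟨_, h⟩, rfl, e⟩ => ⟨h, e⟩, fun ⟨h, e⟩ => ⟨⟨x, h⟩, rfl, e⟩⟩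

theorem mem_graph_everywhere {L : E →ₗ[ℂ] F} {x : E} {y : F} :
    (x, y) ∈ (everywhere L).graph ↔ L x = y := by
  rw [mem_graph_iff_exists]
  exact ⟨fun ⟨_, e⟩ => e, fun e => ⟨trivial, e⟩⟩

theorem mem_graph_opMul {S : F →ₗ.[ℂ] G} {T : E →ₗ.[ℂ] F} {x : E} {z : G} :
    (x, z) ∈ (opMul S T).graph ↔ ∃ y, (x, y) ∈ T.graph ∧ (y, z) ∈ S.graph := by
  simp only [mem_graph_iff_exists]
  constructor
  · rintro ⟨⟨hx, hTx⟩, e⟩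
    exact ⟨_, ⟨hx, rfl⟩, hTx, e⟩
  · rintro ⟨_, ⟨hx, rfl⟩, hTx, e⟩
    exact ⟨⟨hx, hTx⟩, e⟩

theorem mem_graph_opMul_everywhere {S : F →ₗ.[ℂ] G} {L : E →ₗ[ℂ] F} {x : E} {z : G} :
    (x, z) ∈ (opMul S (everywhere L)).graph ↔ (L x, z) ∈ S.graph := by
  simp only [mem_graph_opMul, mem_graph_everywhere, exists_eq_left']

theorem mem_graph_everywhere_opMul {L : F →ₗ[ℂ] G} {T : E →ₗ.[ℂ] F} {x : E} {z : G} :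
    (x, z) ∈ (opMul (everywhere L) T).graph ↔ ∃ y, (x, y) ∈ T.graph ∧ L y = z := by
  simp only [mem_graph_opMul, mem_graph_everywhere]

theorem mem_graph_offDiag {S : F →ₗ.[ℂ] E} {T : E →ₗ.[ℂ] F} {x y : WithLp 2 (E × F)} :
    (x, y) ∈ (offDiag S T).graph ↔ (x.snd, y.fst) ∈ S.graph ∧ (x.fst, y.snd) ∈ T.graph := by
  simp only [mem_graph_iff_exists]
  constructor
  · rintro ⟨h, rfl⟩
    exact ⟨⟨h.2, rfl⟩, ⟨h.1, rfl⟩⟩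
  · rintro ⟨⟨h2, e2⟩, ⟨h1, e1⟩⟩
    refine ⟨⟨h1, h2⟩, WithLp.ofLp_injective 2 (Prod.ext e2 e1)⟩

theorem mem_graph_unitaryConj {W : E ≃ₗᵢ[ℂ] F} {T : E →ₗ.[ℂ] E} {x y : F} :
    (x, y) ∈ (unitaryConj W T).graph ↔ (W.symm x, W.symm y) ∈ T.graph := by
  simp only [mem_graph_iff_exists]
  refine exists_congr fun h => ?_
  change W (T ⟨W.symm x, h⟩) = y ↔ _
  exact W.toEquiv.eq_symm_apply.symm

theorem mem_graph_neg {T : E →ₗ.[ℂ] F} {x : E} {y : F} :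
    (x, y) ∈ (-T).graph ↔ (x, -y) ∈ T.graph := by
  simp only [mem_graph_iff_exists]
  exact exists_congr fun h => neg_eq_iff_eq_neg

theorem mem_graph_I_smul {T : E →ₗ.[ℂ] F} {x : E} {y : F} :
    (x, y) ∈ (Complex.I • T).graph ↔ (x, -Complex.I • y) ∈ T.graph := by
  simp only [mem_graph_iff_exists]
  refine exists_congr fun h => ?_
  change Complex.I • T ⟨x, h⟩ = y ↔ _
  rw [← Complex.inv_I, eq_inv_smul_iff₀ Complex.I_ne_zero]

theorem mem_opKer {T : E →ₗ.[ℂ] F} {x : E} : x ∈ opKer T ↔ (x, 0) ∈ T.graph := by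
  rw [mem_graph_iff_exists]
  constructor
  · rintro ⟨⟨y, hy⟩, h, rfl⟩
    exact ⟨hy, h⟩
  · rintro ⟨h, e⟩
    exact ⟨⟨x, h⟩, e, rfl⟩

theorem linearPMap_ext_graph {S T : E →ₗ.[ℂ] F}
    (h : ∀ x y, (x, y) ∈ S.graph ↔ (x, y) ∈ T.graph) : S = T :=
  LinearPMap.eq_of_eq_graph (Submodule.ext fun _ => h _ _)

theorem mem_graph_adjoint [CompleteSpace E] {T : E →ₗ.[ℂ] F} (hT : Dense (T.domain : Set E))
    {y : F} {x : E} :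
    (y, x) ∈ T†.graph ↔ ∀ a b, (a, b) ∈ T.graph → inner ℂ b y = inner ℂ a x := by
  rw [LinearPMap.adjoint_graph_eq_graph_adjoint hT, Submodule.mem_adjoint_iff]
  simp only [sub_eq_zero]

/-- A closed densely defined operator is its own second adjoint. -/
theorem mem_graph_of_forall_adjoint [CompleteSpace E] [CompleteSpace F] {T : E →ₗ.[ℂ] F}
    (hT : Dense (T.domain : Set E)) (hc : T.IsClosed) {x : E} {y : F}
    (h : ∀ b a, (b, a) ∈ T†.graph → inner ℂ b y = inner ℂ a x) : (x, y) ∈ T.graph := by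
  -- The graph is moved to the Hilbert sum, where a closed subspace equals its double orthogonal
  -- complement.
  let K : Submodule ℂ (WithLp 2 (E × F)) :=
    T.graph.comap (WithLp.linearEquiv 2 ℂ (E × F)).toLinearMap
  have hK : IsClosed (K : Set (WithLp 2 (E × F))) :=
    IsClosed.preimage (WithLp.prod_continuous_ofLp 2 E F) hc
  have : CompleteSpace K := hK.completeSpace_coe
  change WithLp.toLp 2 (x, y) ∈ K
  rw [← K.orthogonal_orthogonal, Submodule.mem_orthogonal]
  intro u hu
  -- Rotating the orthogonal complement of the graph of `T` lands in the graph of `T†`.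
  have h1 : (u.snd, -u.fst) ∈ T†.graph := by
    refine (mem_graph_adjoint hT).2 fun a b hab => ?_
    have h2 := (Submodule.mem_orthogonal _ _).1 hu (WithLp.toLp 2 (a, b)) hab
    rw [WithLp.prod_inner_apply] at h2
    change inner ℂ a u.fst + inner ℂ b u.snd = 0 at h2
    rw [inner_neg_right]
    linear_combination h2
  have h2 := h _ _ h1
  rw [inner_neg_left] at h2
  rw [WithLp.prod_inner_apply]
  change inner ℂ u.fst x + inner ℂ u.snd y = 0
  linear_combination h2

theorem mem_graph_adjoint_zero [CompleteSpace E] {T : E →ₗ.[ℂ] F}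
    (hT : Dense (T.domain : Set E)) {y : F} : (y, 0) ∈ T†.graph ↔ y ∈ (closedRange T)ᗮ := by
  rw [mem_graph_adjoint hT, closedRange, Submodule.orthogonal_closure,
    Submodule.mem_orthogonal]
  simp only [inner_zero_right]
  constructor
  · rintro h _ ⟨x, rfl⟩
    exact h _ _ (T.mem_graph x)
  · intro h a b hab
    obtain ⟨ha, rfl⟩ := mem_graph_iff_exists.1 hab
    exact h _ ⟨⟨a, ha⟩, rfl⟩

end Graphs

/-! ### The wave generator and the reduced Dirac operator -/

section Energy

variable {H₁ H₂ : Type*}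
  [NormedAddCommGroup H₁] [InnerProductSpace ℂ H₁]
  [NormedAddCommGroup H₂] [InnerProductSpace ℂ H₂] [CompleteSpace H₂]
  {A : H₁ →ₗ.[ℂ] H₂}

/-- `A = Ã J_A`. -/
theorem mem_graph_energyEmb {g : H₁} {u : EnergySpace A} :
    (g, u) ∈ (energyEmb A).graph ↔ (g, (unitaryExt A u : H₂)) ∈ A.graph := by
  simp only [mem_graph_iff_exists]
  refine exists_congr fun h => ?_
  change toEnergySpace A ⟨g, h⟩ = u ↔ _
  rw [← unitaryExt_apply, Subtype.coe_inj, EmbeddingLike.apply_eq_iff_eq]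

variable [CompleteSpace H₁]

theorem mem_graph_adjointExt {f : EnergySpace A} {v : H₁} :
    (f, v) ∈ (adjointExt A).graph ↔ ((unitaryExt A f : H₂), v) ∈ A†.graph :=
  mem_graph_opMul_everywhere

/-- This removes the completion from later arguments: `H_A` enters only through `Ã`, leaving
conditions on the graphs of `A` and `A†`. -/
theorem mem_graph_waveGen {x y : WithLp 2 (EnergySpace A × H₁)} :
    (x, y) ∈ (waveGen A).graph ↔ (x.snd, (unitaryExt A y.fst : H₂)) ∈ A.graph ∧
      ((unitaryExt A x.fst : H₂), -y.snd) ∈ A†.graph := by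
  rw [waveGen, mem_graph_offDiag, mem_graph_energyEmb, mem_graph_neg, mem_graph_adjointExt]

omit [CompleteSpace H₁] in
theorem inner_unitaryExt (u f : EnergySpace A) :
    inner ℂ (unitaryExt A u : H₂) (unitaryExt A f : H₂) = inner ℂ u f :=
  (unitaryExt A).inner_map_map u f

/-- Skew symmetry is the adjoint relation used once for each block. For maximality, test vectors in
`H_A ⊕ 0` recover the condition on `A` through `A** = A`, and those in `0 ⊕ dom A` recover the
condition on `A†`. -/
theorem isSkewAdjoint_waveGen (hdense : Dense (A.domain : Set H₁)) (hclosed : A.IsClosed) :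
    IsSkewAdjoint (waveGen A) := by
  intro x y
  constructor
  · intro hxy z w hzw
    rw [mem_graph_waveGen] at hxy hzw
    have h1 := (mem_graph_adjoint hdense).1 hxy.2 _ _ hzw.1
    have h2 := (mem_graph_adjoint hdense).1 hzw.2 _ _ hxy.1
    rw [inner_unitaryExt, inner_neg_right] at h1 h2
    have h3 := congrArg (starRingEnd ℂ) h1
    rw [map_neg, inner_conj_symm, inner_conj_symm] at h3
    rw [WithLp.prod_inner_apply, WithLp.prod_inner_apply]
    change inner ℂ y.fst z.fst + inner ℂ y.snd z.snd =
      -(inner ℂ x.fst w.fst + inner ℂ x.snd w.snd)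
    linear_combination h2 + h3
  · intro h
    rw [mem_graph_waveGen]
    constructor
    · refine mem_graph_of_forall_adjoint hdense hclosed fun b a hba => ?_
      -- A vector `b` of `dom A*` need not lie in the range `K_A` of `Ã`. Its projection `k` does,
      -- and `b - k` lies in `ker A*`, so `(k, a)` is still in the graph of `A†`.
      let k : closedRange A := (closedRange A).orthogonalProjectionOnto b
      have hk : b - k ∈ (closedRange A)ᗮ :=
        (closedRange A).sub_starProjection_mem_orthogonal b
      have h1 := A†.graph.sub_mem hba ((mem_graph_adjoint_zero hdense).2 hk)
      rw [Prod.mk_sub_mk, sub_sub_cancel, sub_zero] at h1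
      have h2 := h (WithLp.toLp 2 ((unitaryExt A).symm k, 0)) (WithLp.toLp 2 (0, -a)) <|
        mem_graph_waveGen.2 ⟨by simp, by simpa using h1⟩
      rw [WithLp.prod_inner_apply, WithLp.prod_inner_apply] at h2
      simp only [inner_zero_right, add_zero, zero_add, inner_neg_right, neg_neg] at h2
      have h3 := congrArg (starRingEnd ℂ) h2
      simp only [inner_conj_symm] at h3
      have h4 : inner ℂ (b - k) (unitaryExt A y.fst : H₂) = 0 :=
        (Submodule.mem_orthogonal' _ _).1 hk _ (unitaryExt A y.fst).2
      rw [inner_sub_left, sub_eq_zero] at h4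
      rw [h4, ← (unitaryExt A).apply_symm_apply k, inner_unitaryExt]
      exact h3
    · refine (mem_graph_adjoint hdense).2 fun a b hab => ?_
      obtain ⟨ha, rfl⟩ := mem_graph_iff_exists.1 hab
      have h2 := h (WithLp.toLp 2 (0, a)) (WithLp.toLp 2 (toEnergySpace A ⟨a, ha⟩, 0)) <|
        mem_graph_waveGen.2 ⟨by simpa [unitaryExt_apply] using hab, by simp⟩
      rw [WithLp.prod_inner_apply, WithLp.prod_inner_apply] at h2
      simp only [inner_zero_right, add_zero, zero_add] at h2
      have h3 := congrArg (starRingEnd ℂ) h2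
      simp only [map_neg, inner_conj_symm] at h3
      rw [← unitaryExt_apply, inner_unitaryExt, inner_neg_right]
      exact (neg_eq_iff_eq_neg.2 h3).symm

theorem mem_graph_blockUnitary_conj {x y : WithLp 2 (H₁ × closedRange A)} :
    (x, y) ∈ (unitaryConj (blockUnitary A) (Complex.I • waveGen A)).graph ↔
      (x.fst, (y.snd : H₂)) ∈ A.graph ∧ ((x.snd : H₂), y.fst) ∈ A†.graph := by
  rw [mem_graph_unitaryConj, mem_graph_I_smul, mem_graph_waveGen]
  change (x.fst, (unitaryExt A (-Complex.I • Complex.I • (unitaryExt A).symm y.snd) : H₂)) ∈ _ ∧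
    ((unitaryExt A (Complex.I • (unitaryExt A).symm x.snd) : H₂), -(-Complex.I • y.fst)) ∈ _ ↔ _
  have e1 : unitaryExt A (-Complex.I • Complex.I • (unitaryExt A).symm y.snd) = y.snd := by
    simp [smul_smul]
  have e2 : ((unitaryExt A (Complex.I • (unitaryExt A).symm x.snd) : H₂), -(-Complex.I • y.fst)) =
      Complex.I • ((x.snd : H₂), y.fst) := by
    simp
  rw [e1, e2, Submodule.smul_mem_iff _ Complex.I_ne_zero]

omit [CompleteSpace H₂] in
theorem mem_opKer_diracOp (hdense : Dense (A.domain : Set H₁)) (hker : opKer A = ⊥)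
    {x : WithLp 2 (H₁ × H₂)} :
    x ∈ opKer (diracOp A) ↔ x.fst = 0 ∧ x.snd ∈ (closedRange A)ᗮ := by
  rw [mem_opKer, diracOp, mem_graph_offDiag, and_comm]
  refine and_congr ?_ (mem_graph_adjoint_zero hdense)
  change (x.fst, 0) ∈ A.graph ↔ _
  rw [← mem_opKer, hker, Submodule.mem_bot]

omit [CompleteSpace H₂] in
-- Needed because `orthProj` projects onto the closure of its argument.
theorem isClosed_opKer_diracOp (hdense : Dense (A.domain : Set H₁)) (hker : opKer A = ⊥) :
    IsClosed (opKer (diracOp A) : Set (WithLp 2 (H₁ × H₂))) := by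
  have h : (opKer (diracOp A) : Set (WithLp 2 (H₁ × H₂))) =
      {x | x.fst = 0} ∩ WithLp.snd ⁻¹' ((closedRange A)ᗮ : Set H₂) := by
    ext x
    exact mem_opKer_diracOp hdense hker
  rw [h]
  have h1 : Continuous fun x : WithLp 2 (H₁ × H₂) => x.fst :=
    continuous_fst.comp (WithLp.prod_continuous_ofLp 2 H₁ H₂)
  have h2 : Continuous fun x : WithLp 2 (H₁ × H₂) => x.snd :=
    continuous_snd.comp (WithLp.prod_continuous_ofLp 2 H₁ H₂)
  exact (isClosed_eq h1 continuous_const).inter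
    ((Submodule.isClosed_orthogonal _).preimage h2)

theorem sub_orthProj_opKer_diracOp (hdense : Dense (A.domain : Set H₁)) (hker : opKer A = ⊥)
    (x : WithLp 2 (H₁ × H₂)) :
    x - orthProj (opKer (diracOp A)) x =
      WithLp.toLp 2 (x.fst, ((closedRange A).orthogonalProjectionOnto x.snd : H₂)) := by
  have hk : x.snd - (closedRange A).orthogonalProjectionOnto x.snd ∈ (closedRange A)ᗮ :=
    (closedRange A).sub_starProjection_mem_orthogonal x.snd
  have h : orthProj (opKer (diracOp A)) x =
      WithLp.toLp 2 (0, x.snd - (closedRange A).orthogonalProjectionOnto x.snd) := by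
    refine Submodule.eq_starProjection_of_mem_of_inner_eq_zero ?_ ?_
    · exact Submodule.le_topologicalClosure _ ((mem_opKer_diracOp hdense hker).2 ⟨rfl, hk⟩)
    · intro w hw
      have hw' : w ∈ opKer (diracOp A) := by
        rwa [(isClosed_opKer_diracOp hdense hker).submodule_topologicalClosure_eq] at hw
      rw [mem_opKer_diracOp hdense hker] at hw'
      rw [WithLp.prod_inner_apply]
      change inner ℂ (x.fst - 0) w.fst + inner ℂ (x.snd - (x.snd -
        ((closedRange A).orthogonalProjectionOnto x.snd : H₂))) w.snd = 0
      rw [hw'.1, inner_zero_right, sub_sub_cancel, zero_add]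
      exact (Submodule.mem_orthogonal _ _).1 hw'.2 _ (Subtype.property _)
  rw [h]
  refine WithLp.ofLp_injective 2 (Prod.ext ?_ ?_)
  · exact sub_zero x.fst
  · exact sub_sub_cancel x.snd _

theorem mem_graph_reducedDirac (hdense : Dense (A.domain : Set H₁)) (hker : opKer A = ⊥)
    {x z : WithLp 2 (H₁ × H₂)} :
    (x, z) ∈ (reducedDirac A).graph ↔ (x.fst, z.snd) ∈ A.graph ∧
      (((closedRange A).orthogonalProjectionOnto x.snd : H₂), z.fst) ∈ A†.graph := by
  rw [reducedDirac, mem_graph_opMul_everywhere]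
  change (x - orthProj (opKer (diracOp A)) x, z) ∈ _ ↔ _
  rw [sub_orthProj_opKer_diracOp hdense hker, diracOp, mem_graph_offDiag, and_comm]
  exact Iff.rfl

omit [CompleteSpace H₁] [CompleteSpace H₂] in
theorem snd_mem_closedRange {x : H₁} {y : H₂} (h : (x, y) ∈ A.graph) : y ∈ closedRange A := by
  obtain ⟨hx, rfl⟩ := mem_graph_iff_exists.1 h
  exact mem_closedRange A ⟨x, hx⟩

/-- The adjoint of the inclusion is the projection onto `H₁ ⊕ K_A`, so sandwiching an operator
between the inclusion and its adjoint extends it by zero on `0 ⊕ K_Aᗮ`. -/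
theorem adjoint_blockIncl_apply (x : WithLp 2 (H₁ × H₂)) :
    ContinuousLinearMap.adjoint (blockIncl A).toContinuousLinearMap x =
      WithLp.toLp 2 (x.fst, (closedRange A).orthogonalProjectionOnto x.snd) := by
  refine ext_inner_right ℂ fun y => ?_
  rw [ContinuousLinearMap.adjoint_inner_left, WithLp.prod_inner_apply, WithLp.prod_inner_apply]
  change inner ℂ x.fst y.fst + inner ℂ x.snd (y.snd : H₂) = inner ℂ x.fst y.fst +
    inner ℂ ((closedRange A).orthogonalProjectionOnto x.snd) y.snd
  rw [Submodule.inner_orthogonalProjectionOnto_eq_of_mem_right]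

theorem reducedDirac_eq (hdense : Dense (A.domain : Set H₁)) (hker : opKer A = ⊥) :
    reducedDirac A =
      opMul (everywhere (blockIncl A).toLinearMap)
        (opMul (unitaryConj (blockUnitary A) (Complex.I • waveGen A))
          (everywhere
            (ContinuousLinearMap.adjoint (blockIncl A).toContinuousLinearMap).toLinearMap)) := by
  refine linearPMap_ext_graph fun x z => ?_
  rw [mem_graph_reducedDirac hdense hker, mem_graph_everywhere_opMul]
  simp only [mem_graph_opMul_everywhere, mem_graph_blockUnitary_conj,
    ContinuousLinearMap.coe_coe, adjoint_blockIncl_apply]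
  constructor
  · rintro ⟨h1, h2⟩
    -- The output already lies in `H₁ ⊕ K_A`, since its second component is a value of `A`.
    exact ⟨WithLp.toLp 2 (z.fst, ⟨z.snd, snd_mem_closedRange h1⟩), ⟨h1, h2⟩, rfl⟩
  · rintro ⟨y, h, rfl⟩
    exact h

theorem reducedDirac_comp_blockIncl (hdense : Dense (A.domain : Set H₁)) (hker : opKer A = ⊥) :
    opMul (reducedDirac A) (everywhere (blockIncl A).toLinearMap) =
      opMul (everywhere (blockIncl A).toLinearMap)
        (unitaryConj (blockUnitary A) (Complex.I • waveGen A)) := by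
  refine linearPMap_ext_graph fun x z => ?_
  rw [mem_graph_opMul_everywhere, mem_graph_reducedDirac hdense hker, mem_graph_everywhere_opMul]
  simp only [mem_graph_blockUnitary_conj]
  have e : (closedRange A).orthogonalProjectionOnto ((blockIncl A).toLinearMap x).snd = x.snd :=
    Submodule.orthogonalProjectionOnto_mem_subspace_eq_self x.snd
  rw [e]
  constructor
  · rintro ⟨h1, h2⟩
    exact ⟨WithLp.toLp 2 (z.fst, ⟨z.snd, snd_mem_closedRange h1⟩), ⟨h1, h2⟩, rfl⟩
  · rintro ⟨y, h, rfl⟩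
    exact h

/-- The unitary `(I 0; 0 -I)`. -/
def signFlip (E F : Type*) [NormedAddCommGroup E] [InnerProductSpace ℂ E]
    [NormedAddCommGroup F] [InnerProductSpace ℂ F] : WithLp 2 (E × F) ≃ₗᵢ[ℂ] WithLp 2 (E × F) where
  toFun x := WithLp.toLp 2 (x.fst, -x.snd)
  invFun x := WithLp.toLp 2 (x.fst, -x.snd)
  map_add' x y := by
    rw [WithLp.add_fst, WithLp.add_snd, neg_add]
    rfl
  map_smul' c x := by
    rw [WithLp.smul_fst, WithLp.smul_snd, ← smul_neg]
    rfl
  left_inv x := WithLp.ofLp_injective 2 (Prod.ext rfl (neg_neg x.snd))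
  right_inv x := WithLp.ofLp_injective 2 (Prod.ext rfl (neg_neg x.snd))
  norm_map' x := by
    simp [WithLp.prod_norm_eq_of_L2]

/-- Flipping the sign of the second summand reverses the sign of both off-diagonal blocks. -/
theorem unitarilyEquivalent_neg_waveGen : UnitarilyEquivalent (waveGen A) (-waveGen A) := by
  refine ⟨signFlip _ _, linearPMap_ext_graph fun x y => ?_⟩
  rw [mem_graph_unitaryConj, mem_graph_neg, mem_graph_waveGen, mem_graph_waveGen]
  change (-x.snd, (unitaryExt A y.fst : H₂)) ∈ _ ∧ ((unitaryExt A x.fst : H₂), - -y.snd) ∈ _ ↔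
    (x.snd, (unitaryExt A (-y.fst) : H₂)) ∈ _ ∧ ((unitaryExt A x.fst : H₂), - -y.snd) ∈ _
  refine and_congr_left fun _ => ?_
  rw [← A.graph.neg_mem_iff]
  simp

end Energy

end AbstractWave

end

open AbstractWave in
open scoped LinearPMap in
theorem theorem3p5 {H₁ H₂ : Type*}
    [NormedAddCommGroup H₁] [InnerProductSpace ℂ H₁] [CompleteSpace H₁]
    [TopologicalSpace.SeparableSpace H₁]
    [NormedAddCommGroup H₂] [InnerProductSpace ℂ H₂] [CompleteSpace H₂]
    [TopologicalSpace.SeparableSpace H₂]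
    (A : H₁ →ₗ.[ℂ] H₂)
    (hdense : Dense (A.domain : Set H₁))
    (hclosed : A.IsClosed)
    (hker : opKer A = ⊥)
    (hspec : IsGLB {r : ℝ | (r : ℂ) ∈ spectrumOf (opMul A† A)} 0) :
    -- `H₁ ⊕ K_A` is invariant under `Q (I - P)`, whose part there is `U (i G) U⁻¹`,
    opMul (reducedDirac A) (everywhere (blockIncl A).toLinearMap) =
      opMul (everywhere (blockIncl A).toLinearMap)
        (unitaryConj (blockUnitary A) (Complex.I • waveGen A)) ∧
    -- and on all of `H₁ ⊕ H₂`, `Q (I - P)` is the extension of `U (i G) U⁻¹` by `0`,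
    reducedDirac A =
      opMul (everywhere (blockIncl A).toLinearMap)
        (opMul (unitaryConj (blockUnitary A) (Complex.I • waveGen A))
          (everywhere
            (ContinuousLinearMap.adjoint (blockIncl A).toContinuousLinearMap).toLinearMap)) ∧
    IsSelfAdjoint (Complex.I • waveGen A) ∧
    GeneratesUnitaryGroup (waveGen A) ∧
    UnitarilyEquivalent (waveGen A) (-waveGen A) := by
  exact ⟨reducedDirac_comp_blockIncl hdense hker, reducedDirac_eq hdense hker,
    (isSkewAdjoint_waveGen hdense hclosed).isSelfAdjoint_I_smul,
    (isSkewAdjoint_waveGen hdense hclosed).generatesUnitaryGroup,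
    unitarilyEquivalent_neg_waveGen⟩
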